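/- Let $\mathbb{E}$ be a finite-dimensional real vector space with Euclidean norm $\|x\|=\langle Bx,x\rangle^{1/2}$, $B\succ 0$, and let $\|\cdot\|_*$ be the conjugate norm on $\mathbb{E}^*$. Let $\nu\in[0,1]$ and let $f:\mathbb{E}\to\mathbb{R}$ be convex and three times differentiable, with $$\|D^3f(u)-D^3f(v)\|\le H_{f,3}(\nu)\,\|u-v\|^{\nu}\qquad\text{for all } u,v\in\mathbb{E},$$ where $H_{f,3}(\nu)>0$ is a constant. For $x\in\mathbb{E}$ and $H>0$ put $$\Omega(y)=f(x)+\sum_{i=1}^{3}\frac1{i!}D^if(x)[y-x]^i+\frac H6\|y-x\|^{3+\nu},$$ $$\rho_x(y)=\tfrac12\langle\nabla^2f(x)(y-x),y-x\rangle+\tfrac1{3+\nu}\|y-x\|^{3+\nu},$$ and let $\beta_{\rho_x}(u,v)=\rho_x(v)-\rho_x(u)-\langle\nabla\rho_x(u),v-u\rangle$. Algorithm 1. Choose $L_0>0$ and set $y_0=x$. For $k=0,1,2,\dots$ and $i=0,1,2,\dots$ compute $$y_{k,i}^+\in\arg\min_{z\in\mathbb{E}}\{\langle\nabla\Omega(y_k),z-y_k\rangle+2^iL_k\beta_{\rho_x}(y_k,z)\},$$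 let $i_k$ be the first $i$ such that $$\Omega(y_{k,i}^+)\le\Omega(y_k)+\langle\nabla\Omega(y_k),y_{k,i}^+-y_k\rangle+2^iL_k\beta_{\rho_x}(y_k,y_{k,i}^+),$$ and set $y_{k+1}=y_{k,i_k}^+$, $L_{k+1}=2^{i_k-1}L_k$. Let $\tau_H=\Big[\frac{(3+\nu)H}{6H_{f,3}(\nu)}\Big]^{1/(1+\nu)}$ and $$L_H=\max\Big\{\frac{\tau_H+1}{\tau_H},\ \tau_H^{\nu}(\tau_H+1)H_{f,3}(\nu)\Big\},\qquad \mu_H=\min\Big\{\frac{\tau_H-1}{\tau_H},\ \tau_H^{\nu}(\tau_H-1)H_{f,3}(\nu)\Big\},$$ $$M_H=\max\{2L_0,4L_H\},\qquad N_x=\|\nabla^2f(x)\|+12R_0^2,\qquad C_{x,H}=\log_2\Big(\frac{4(3+\nu)M_H^{2+\nu}N_x^3\mu_H}{2^{-(1+\nu)}}\Big).$$ Theorem. Suppose that $f$ has a global minimizer $x^*$, that $f(x)\le f(x_0)$, and that $\|y-x^*\|\le R_0$ whenever $f(y)\le f(x_0)$, where $1\le R_0<+\infty$. Suppose that $H>\frac{6}{3+\nu}H_{f,3}(\nu)$.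 Let $\{y_k\}_{k\ge0}$ be a sequence generated by Algorithm 1, let $\epsilon\in(0,1)$, and let $T\ge0$ be an integer such that $\|\nabla\Omega(y_{T+1})\|_*>\epsilon$. Then $$T\le\Big[\log_2\Big(\frac{M_H}{M_H-\mu_H}\Big)\Big]^{-1}\max\big\{1,\ C_{x,H}+(3+\nu)\log_2(\epsilon^{-1})\big\}.$$ If moreover $\epsilon\le\frac12$, then $$T\le\Big[\log_2\Big(\frac{M_H}{M_H-\mu_H}\Big)\Big]^{-1}\big[\max\{C_{x,H},0\}+(3+\nu)\big]\log_2(\epsilon^{-1}).$$ -/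

import Mathlib

/-!
A finite-dimensional real vector space with the Euclidean norm `‖x‖ = ⟨B x, x⟩^{1/2}`, `B ≻ 0`, is a
finite-dimensional real inner product space whose inner product is `⟨B x, y⟩`. The dual space is
`E →L[ℝ] ℝ`, its operator norm is the conjugate norm `‖s‖_* = ⟨s, B⁻¹ s⟩^{1/2}`, the gradient is
`fderiv`, and the form `D^i f(x)` is `iteratedFDeriv ℝ i f x` with its operator norm.
-/

noncomputable section

namespace BregmanTensor

variable {E : Type*} [NormedAddCommGroup E] [InnerProductSpace ℝ E]

/-- `f` is `p` times differentiable on the whole space. -/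
def TimesDifferentiable (p : ℕ) (f : E → ℝ) : Prop :=
  ∀ m < p, Differentiable ℝ (iteratedFDeriv ℝ m f)

/-- The `p`th derivative of `f` is `ν`-Hölder continuous with constant `Hf`. -/
def HolderDeriv (p : ℕ) (ν Hf : ℝ) (f : E → ℝ) : Prop :=
  ∀ x y : E, ‖iteratedFDeriv ℝ p f x - iteratedFDeriv ℝ p f y‖ ≤ Hf * ‖x - y‖ ^ ν

/-- The `p`th order Taylor polynomial `Φ_{x,p}` of `f` at `x`. -/
def taylorPoly (f : E → ℝ) (x : E) (p : ℕ) (y : E) : ℝ :=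
  ∑ i ∈ Finset.range (p + 1),
    (1 / (i.factorial : ℝ)) * iteratedFDeriv ℝ i f x (fun _ => y - x)

/-- The regularized tensor model `Ω_{x,p,H}^{(ν)}`. -/
def tensorModel (f : E → ℝ) (x : E) (p : ℕ) (H ν : ℝ) (y : E) : ℝ :=
  taylorPoly f x p y + H / (p.factorial : ℝ) * ‖y - x‖ ^ ((p : ℝ) + ν)

/-- The scaling function `ρ_x`. -/
def scaling (f : E → ℝ) (x : E) (ν : ℝ) (y : E) : ℝ :=
  1 / 2 * iteratedFDeriv ℝ 2 f x (fun _ => y - x) + 1 / (3 + ν) * ‖y - x‖ ^ (3 + ν)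

/-- The Bregman distance `β_d(u, v) = d(v) - d(u) - ⟨∇d(u), v - u⟩`. -/
def bregman (d : E → ℝ) (u v : E) : ℝ :=
  d v - d u - fderiv ℝ d u (v - u)

/-- The objective `⟨∇g(u), z - u⟩ + c β_d(u, z)` of the proximal step at `u`. -/
def proxObjective (g d : E → ℝ) (u : E) (c : ℝ) (z : E) : ℝ :=
  fderiv ℝ g u (z - u) + c * bregman d u z

/-- The acceptance test of the line search at `u` for the trial point `z`. -/
def Accepted (g d : E → ℝ) (u : E) (c : ℝ) (z : E) : Prop :=
  g z ≤ g u + fderiv ℝ g u (z - u) + c * bregman d u z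

/-- `y` is a sequence generated by the adaptive Bregman gradient method for minimizing `g` with
scaling function `d`, starting point `y₀` and initial estimate `L₀`. At iteration `k`, `L k` is the
current estimate, `trial k j` is the trial point computed for the inner counter `j`, and `i k` is the
first value of the inner counter for which the trial point is accepted. -/
def GeneratedByBregmanMethod (g d : E → ℝ) (y₀ : E) (L₀ : ℝ) (y : ℕ → E) : Prop :=
  ∃ (L : ℕ → ℝ) (i : ℕ → ℕ) (trial : ℕ → ℕ → E),
    y 0 = y₀ ∧ L 0 = L₀ ∧
    ∀ k : ℕ,
      (∀ j ≤ i k, IsMinOn (proxObjective g d (y k) (2 ^ j * L k)) Set.univ (trial k j)) ∧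
      (∀ j < i k, ¬ Accepted g d (y k) (2 ^ j * L k) (trial k j)) ∧
      Accepted g d (y k) (2 ^ i k * L k) (trial k (i k)) ∧
      y (k + 1) = trial k (i k) ∧
      L (k + 1) = (2 : ℝ) ^ ((i k : ℤ) - 1) * L k

/-- `τ_H` -/
def tauH (ν H Hf : ℝ) : ℝ :=
  ((3 + ν) * H / (6 * Hf)) ^ (1 / (1 + ν))

/-- The relative smoothness constant `L_H`. -/
def smoothH (ν H Hf : ℝ) : ℝ :=
  max ((tauH ν H Hf + 1) / tauH ν H Hf) (tauH ν H Hf ^ ν * (tauH ν H Hf + 1) * Hf)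

/-- The relative strong convexity constant `μ_H`. -/
def muH (ν H Hf : ℝ) : ℝ :=
  min ((tauH ν H Hf - 1) / tauH ν H Hf) (tauH ν H Hf ^ ν * (tauH ν H Hf - 1) * Hf)

/-- `M_H = max {2 L₀, 4 L_H}` -/
def bigMH (ν H Hf L₀ : ℝ) : ℝ :=
  max (2 * L₀) (4 * smoothH ν H Hf)

/-- `N_x = ‖∇²f(x)‖ + 12 R₀²` -/
def bigNx (f : E → ℝ) (x : E) (R₀ : ℝ) : ℝ :=
  ‖iteratedFDeriv ℝ 2 f x‖ + 12 * R₀ ^ 2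

/-- `C_{x,H}` -/
def constC (f : E → ℝ) (x : E) (ν H Hf L₀ R₀ : ℝ) : ℝ :=
  Real.logb 2
    (4 * (3 + ν) * bigMH ν H Hf L₀ ^ (2 + ν) * bigNx f x R₀ ^ 3 * muH ν H Hf /
      (2 : ℝ) ^ (-(1 + ν)))

end BregmanTensor

end

/-! Convexity controls the third derivative of $f$. Inserting Taylor's bound into $D^2f(x+\tau
h)[w,w]\ge 0$, for both $h$ and $-h$, gives $|D^3f(x)[h,w,w]|\le\frac1\tau D^2f(x)[w,w]+\tau^\nu
H_f\|h\|^{1+\nu}\|w\|^2$. With $\tau=\tau_H$ the last coefficient is $1/\tau_H$ times that of the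
Hessian of the regularizer. So the Hessian of $\Omega$ lies between $\mu_H$ and $L_H$ times that of
$\rho_x$ (`exists_second_deriv_bounds`), and integrating along segments compares the Bregman
distances.

Relative smoothness keeps the accepted constants below $M=M_H$, and relative strong convexity makes
the method linear: with $r=M/(M-\mu)$, $\mu=\mu_H$ and $z$ a minimizer of $\Omega$, the gap $G$
after $n$ steps satisfies $G(r^n-1)\le\mu\beta_{\rho_x}(x,z)$ (`gap_mul_le`).

Since $\Omega\ge f$ with equality at $x$, the iterates and $z$ stay within $2R_0$ of $x$. There
$\beta_{\rho_x}(x,z)\le N_x^2/6$ (`bregman_scaling_le`), while a gradient larger than $\epsilon$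
forces $G\ge\epsilon^2/(6L_HN_x)$ by a short descent step (`gap_ge_of_norm_fderiv_gt`). Taking
logarithms at $n=T+1$ bounds $T$. -/

namespace BregmanTensor

open Filter Topology Set

variable {E : Type*} [NormedAddCommGroup E] [InnerProductSpace ℝ E]

/-! ### Calculus along lines, and the power of the norm -/

section Calculus

/-- A function on the line whose second derivative is nonnegative on `[0, 1]` lies above its tangent
at `0`. -/
theorem tangent_le_of_second_deriv_nonneg {φ φ' : ℝ → ℝ}
    (h1 : ∀ t, HasDerivAt φ (φ' t) t)
    (h2 : ∀ t ∈ Icc (0 : ℝ) 1, ∃ c, 0 ≤ c ∧ HasDerivAt φ' c t) :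
    φ 0 + φ' 0 ≤ φ 1 := by
  have hmono : MonotoneOn φ' (Icc (0 : ℝ) 1) := by
    refine monotoneOn_of_deriv_nonneg (convex_Icc 0 1) ?_ ?_ ?_
    · intro t ht
      obtain ⟨c, -, hc⟩ := h2 t ht
      exact hc.continuousAt.continuousWithinAt
    · intro t ht
      obtain ⟨c, -, hc⟩ := h2 t (interior_subset ht)
      exact hc.differentiableAt.differentiableWithinAt
    · intro t ht
      obtain ⟨c, hc0, hc⟩ := h2 t (interior_subset ht)
      rwa [hc.deriv]
  -- The mean value theorem replaces an integral remainder, so no regularity of the second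
  -- derivative is needed.
  obtain ⟨c, hc, hc'⟩ := exists_hasDerivAt_eq_slope φ φ' (zero_lt_one' ℝ)
    (fun t _ => (h1 t).continuousAt.continuousWithinAt) (fun t _ => h1 t)
  have := hmono (left_mem_Icc.2 zero_le_one) ⟨hc.1.le, hc.2.le⟩ hc.1.le
  rw [hc'] at this
  linarith [this]

theorem hasDerivAt_apply_const {F : Type*} [NormedAddCommGroup F] [NormedSpace ℝ F]
    {A : ℝ → E →L[ℝ] F} {A' : E →L[ℝ] F} {t : ℝ} (h : HasDerivAt A A' t) (w : E) :
    HasDerivAt (fun s => A s w) (A' w) t :=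
  (ContinuousLinearMap.apply ℝ F w).hasFDerivAt.comp_hasDerivAt t h

theorem hasDerivAt_comp_line {F : Type*} [NormedAddCommGroup F] [NormedSpace ℝ F]
    {A : E → F} (hA : Differentiable ℝ A) (u w : E) (t : ℝ) :
    HasDerivAt (fun s : ℝ => A (u + s • w)) (fderiv ℝ A (u + t • w) w) t := by
  have hl : HasDerivAt (fun s : ℝ => u + s • w) w t := by
    simpa using ((hasDerivAt_id t).smul_const w).const_add u
  exact (hA (u + t • w)).hasFDerivAt.comp_hasDerivAt t hl

theorem differentiable_of_iteratedFDeriv_zero {F : Type*} [NormedAddCommGroup F] [NormedSpace ℝ F]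
    {A : E → F} (h : Differentiable ℝ (iteratedFDeriv ℝ 0 A)) : Differentiable ℝ A :=
  (ContinuousMultilinearMap.apply ℝ (fun _ : Fin 0 => E) F 0).differentiable.comp h

/-- Currying the last slot is a linear isometry. Repeated use turns `TimesDifferentiable 3` into
differentiability of nested `fderiv`s; $f$ is not assumed to be $C^3$. -/
theorem differentiable_iteratedFDeriv_fderiv {F : Type*} [NormedAddCommGroup F] [NormedSpace ℝ F]
    {A : E → F} {n : ℕ} (h : Differentiable ℝ (iteratedFDeriv ℝ (n + 1) A)) :
    Differentiable ℝ (iteratedFDeriv ℝ n (fderiv ℝ A)) := by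
  have e : iteratedFDeriv ℝ n (fderiv ℝ A) =
      (continuousMultilinearCurryRightEquiv' ℝ n E F) ∘ iteratedFDeriv ℝ (n + 1) A := by
    funext z
    simp only [Function.comp_apply, iteratedFDeriv_succ_eq_comp_right,
      LinearIsometryEquiv.apply_symm_apply]
  rw [e]
  exact (LinearIsometryEquiv.comp_differentiable_iff _).2 h

theorem hasDerivAt_comp_line_apply_apply {F : Type*} [NormedAddCommGroup F] [NormedSpace ℝ F]
    {B : E → E →L[ℝ] E →L[ℝ] F} (hB : Differentiable ℝ B) (u w a b : E) (t : ℝ) :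
    HasDerivAt (fun s : ℝ => B (u + s • w) a b) (fderiv ℝ B (u + t • w) w a b) t := by
  have h1 : HasDerivAt (fun s : ℝ => B (u + s • w)) (fderiv ℝ B (u + t • w) w) t :=
    hasDerivAt_comp_line (A := B) hB u w t
  have h2 : HasDerivAt (fun s : ℝ => B (u + s • w) a) (fderiv ℝ B (u + t • w) w a) t :=
    hasDerivAt_apply_const h1 a
  exact hasDerivAt_apply_const h2 b

theorem hasDerivAt_fderiv_line {F : Type*} [NormedAddCommGroup F] [NormedSpace ℝ F]
    {A : E → F} (hA : Differentiable ℝ (fderiv ℝ A)) (u w a : E) (t : ℝ) :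
    HasDerivAt (fun s : ℝ => fderiv ℝ A (u + s • w) a)
      (fderiv ℝ (fderiv ℝ A) (u + t • w) w a) t :=
  hasDerivAt_apply_const (hasDerivAt_comp_line hA u w t) a

theorem hasDerivAt_line (u w x : E) (t : ℝ) :
    HasDerivAt (fun s : ℝ => u + s • w - x) w t := by
  simpa using (((hasDerivAt_id t).smul_const w).const_add u).sub_const x

/-- The second derivative of `‖· - x‖ ^ (q + 2) / (q + 2)` along a line. -/
theorem exists_hasDerivAt_norm_rpow_mul_inner {q : ℝ} (hq : 1 ≤ q) (u w x : E) (t : ℝ) :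
    ∃ c, HasDerivAt (fun s : ℝ => ‖u + s • w - x‖ ^ q * inner ℝ (u + s • w - x) w) c t ∧
      ‖u + t • w - x‖ ^ q * ‖w‖ ^ 2 ≤ c ∧
      c ≤ (q + 1) * ‖u + t • w - x‖ ^ q * ‖w‖ ^ 2 := by
  have hline := hasDerivAt_line u w x t
  have hin : HasDerivAt (fun s : ℝ => inner ℝ (u + s • w - x) w) (‖w‖ ^ 2) t := by
    simpa [real_inner_self_eq_norm_sq] using hline.inner ℝ (hasDerivAt_const t w)
  by_cases hz : u + t • w - x = 0
  · refine ⟨0, ?_, by simp [hz, Real.zero_rpow (by linarith : q ≠ 0)],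
      by simp [hz, Real.zero_rpow (by linarith : q ≠ 0)]⟩
    -- At a zero of the line the slope of the product is the norm power, which tends to 0, times the
    -- convergent slope of the inner product.
    have hcont : Tendsto (fun s : ℝ => ‖u + s • w - x‖ ^ q) (𝓝[≠] t) (𝓝 0) := by
      have h1 : ContinuousAt (fun s : ℝ => ‖u + s • w - x‖ ^ q) t :=
        hline.continuousAt.norm.rpow_const (Or.inr (by linarith))
      have h2 := h1.tendsto
      simp only [hz, norm_zero, Real.zero_rpow (by linarith : q ≠ 0)] at h2
      exact h2.mono_left nhdsWithin_le_nhds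
    rw [hasDerivAt_iff_tendsto_slope] at hin ⊢
    have := hcont.mul hin
    rw [zero_mul] at this
    refine this.congr fun s => ?_
    simp only [slope_def_field, hz, inner_zero_left, mul_zero, sub_zero]
    ring
  · set z := u + t • w - x with hzdef
    have hzpos : 0 < ‖z‖ := norm_pos_iff.2 hz
    have hsq : HasDerivAt (fun s : ℝ => ‖u + s • w - x‖ ^ 2) (2 * inner ℝ z w) t :=
      hline.norm_sq
    have hpow : HasDerivAt (fun s : ℝ => (‖u + s • w - x‖ ^ 2) ^ (q / 2))
        (2 * inner ℝ z w * (q / 2) * (‖z‖ ^ 2) ^ (q / 2 - 1)) t :=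
      hsq.rpow_const (Or.inl (by positivity))
    have hfun : (fun s : ℝ => (‖u + s • w - x‖ ^ 2) ^ (q / 2)) =
        fun s : ℝ => ‖u + s • w - x‖ ^ q := by
      funext s
      rw [← Real.rpow_natCast, ← Real.rpow_mul (norm_nonneg _)]
      congr 1
      push_cast
      ring
    rw [hfun] at hpow
    have hz2 : (‖z‖ ^ 2) ^ (q / 2 - 1) = ‖z‖ ^ (q - 2) := by
      rw [← Real.rpow_natCast, ← Real.rpow_mul (norm_nonneg _)]
      congr 1
      push_cast
      ring
    have hzq : ‖z‖ ^ q = ‖z‖ ^ (q - 2) * ‖z‖ ^ 2 := by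
      rw [← Real.rpow_natCast, ← Real.rpow_add hzpos]
      congr 1
      push_cast
      ring
    -- The derivative is $q\|z\|^{q-2}\langle z,w\rangle^2+\|z\|^q\|w\|^2$. Drop the first term for
    -- the lower bound; apply Cauchy–Schwarz to it for the upper one.
    refine ⟨_, hpow.mul hin, ?_, ?_⟩
    · rw [hz2]
      have : 0 ≤ 2 * inner ℝ z w * (q / 2) * ‖z‖ ^ (q - 2) * inner ℝ z w := by
        have h : 2 * inner ℝ z w * (q / 2) * ‖z‖ ^ (q - 2) * inner ℝ z w =
          q * ‖z‖ ^ (q - 2) * (inner ℝ z w) ^ 2 := by ring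
        rw [h]
        positivity
      linarith
    · rw [hz2]
      have hcs : (inner ℝ z w) ^ 2 ≤ ‖z‖ ^ 2 * ‖w‖ ^ 2 := by
        rw [← mul_pow]
        exact sq_le_sq.2 ((abs_real_inner_le_norm z w).trans (le_abs_self _))
      have h0 : 0 ≤ q * ‖z‖ ^ (q - 2) := by positivity
      have := mul_le_mul_of_nonneg_left hcs h0
      rw [← hzdef, hzq]
      linarith

end Calculus

/-! ### Symmetry, convexity and Taylor bounds for the derivatives of $f$ -/

section Derivatives

variable {f : E → ℝ}

theorem TimesDifferentiable.differentiable (hf : TimesDifferentiable 3 f) : Differentiable ℝ f :=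
  differentiable_of_iteratedFDeriv_zero (hf 0 (by norm_num))

theorem TimesDifferentiable.differentiable_fderiv (hf : TimesDifferentiable 3 f) :
    Differentiable ℝ (fderiv ℝ f) :=
  differentiable_of_iteratedFDeriv_zero (differentiable_iteratedFDeriv_fderiv (hf 1 (by norm_num)))

theorem TimesDifferentiable.differentiable_fderiv_fderiv (hf : TimesDifferentiable 3 f) :
    Differentiable ℝ (fderiv ℝ (fderiv ℝ f)) :=
  differentiable_of_iteratedFDeriv_zero (differentiable_iteratedFDeriv_fderiv
    (differentiable_iteratedFDeriv_fderiv (hf 2 (by norm_num))))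

theorem iteratedFDeriv_three_apply (f : E → ℝ) (z : E) (m : Fin 3 → E) :
    iteratedFDeriv ℝ 3 f z m =
      fderiv ℝ (fderiv ℝ (fderiv ℝ f)) z (m 0) (m 1) (m 2) := by
  simp [iteratedFDeriv_succ_apply_right, Fin.init]

theorem TimesDifferentiable.second_symm (hf : TimesDifferentiable 3 f) (z v w : E) :
    fderiv ℝ (fderiv ℝ f) z v w = fderiv ℝ (fderiv ℝ f) z w v :=
  second_derivative_symmetric (𝕜 := ℝ) (fun y => (hf.differentiable y).hasFDerivAt)
    (hf.differentiable_fderiv z).hasFDerivAt v w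

theorem TimesDifferentiable.third_symm_left (hf : TimesDifferentiable 3 f) (z v w : E) :
    fderiv ℝ (fderiv ℝ (fderiv ℝ f)) z v w = fderiv ℝ (fderiv ℝ (fderiv ℝ f)) z w v :=
  second_derivative_symmetric (𝕜 := ℝ) (fun y => (hf.differentiable_fderiv y).hasFDerivAt)
    (hf.differentiable_fderiv_fderiv z).hasFDerivAt v w

/-- Differentiate the symmetry of the second derivative in the direction `u`. -/
theorem TimesDifferentiable.third_symm_right (hf : TimesDifferentiable 3 f) (z u v w : E) :
    fderiv ℝ (fderiv ℝ (fderiv ℝ f)) z u v w = fderiv ℝ (fderiv ℝ (fderiv ℝ f)) z u w v := by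
  have h1 : ∀ a b : E, HasDerivAt (fun s : ℝ => fderiv ℝ (fderiv ℝ f) (z + s • u) a b)
      (fderiv ℝ (fderiv ℝ (fderiv ℝ f)) (z + (0 : ℝ) • u) u a b) 0 := fun a b =>
    hasDerivAt_comp_line_apply_apply hf.differentiable_fderiv_fderiv z u a b 0
  have h2 := h1 v w
  have e : (fun s : ℝ => fderiv ℝ (fderiv ℝ f) (z + s • u) v w) =
      fun s : ℝ => fderiv ℝ (fderiv ℝ f) (z + s • u) w v :=
    funext fun s => hf.second_symm _ v w
  rw [e] at h2
  have := h2.unique (h1 w v)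
  simpa only [zero_smul, add_zero] using this

theorem ConvexOn.second_fderiv_nonneg (hc : ConvexOn ℝ univ f) (hf : TimesDifferentiable 3 f)
    (z w : E) : 0 ≤ fderiv ℝ (fderiv ℝ f) z w w := by
  have h1 : ∀ t, HasDerivAt (fun s : ℝ => f (z + s • w)) (fderiv ℝ f (z + t • w) w) t := fun t =>
    hasDerivAt_comp_line hf.differentiable z w t
  have h2 : HasDerivAt (fun s : ℝ => fderiv ℝ f (z + s • w) w)
      (fderiv ℝ (fderiv ℝ f) (z + (0 : ℝ) • w) w w) 0 :=
    hasDerivAt_fderiv_line hf.differentiable_fderiv z w w 0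
  have hconv : ConvexOn ℝ univ (fun s : ℝ => f (z + s • w)) := by
    have := hc.comp_affineMap (AffineMap.lineMap z (z + w) : ℝ →ᵃ[ℝ] E)
    simpa [Function.comp_def, AffineMap.lineMap_apply, add_comm] using this
  have hm := hconv.monotoneOn_deriv (fun t _ => (h1 t).differentiableAt)
  have hm' : Monotone (fun s : ℝ => fderiv ℝ f (z + s • w) w) := by
    intro s t hst
    have := hm (mem_univ s) (mem_univ t) hst
    rwa [(h1 s).deriv, (h1 t).deriv] at this
  have := hm'.deriv_nonneg (x := 0)
  rwa [h2.deriv, zero_smul, add_zero] at this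

variable {ν Hf : ℝ}

/-- Taylor's bound for the second derivative in a fixed direction. -/
theorem abs_second_fderiv_sub_le (hf : TimesDifferentiable 3 f) (hν : 0 ≤ ν) (hHf : 0 < Hf)
    (hh : HolderDeriv 3 ν Hf f) (x h w : E) :
    |fderiv ℝ (fderiv ℝ f) (x + h) w w - fderiv ℝ (fderiv ℝ f) x w w -
      fderiv ℝ (fderiv ℝ (fderiv ℝ f)) x h w w| ≤ Hf * ‖h‖ ^ (1 + ν) * ‖w‖ ^ 2 := by
  rcases eq_or_ne h 0 with rfl | hne
  · simp [Real.zero_rpow (by linarith : 1 + ν ≠ 0)]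
  have hpos : 0 < ‖h‖ := norm_pos_iff.2 hne
  have h2 : ∀ t, HasDerivAt (fun s : ℝ => fderiv ℝ (fderiv ℝ f) (x + s • h) w w)
      (fderiv ℝ (fderiv ℝ (fderiv ℝ f)) (x + t • h) h w w) t := fun t =>
    hasDerivAt_comp_line_apply_apply hf.differentiable_fderiv_fderiv x h w w t
  -- The mean value theorem loses the factor $1/(1+\nu)$ of the integral form; $\tau_H$ is defined
  -- with the constant obtained here.
  obtain ⟨c, hc, hc'⟩ := exists_hasDerivAt_eq_slope _ _ (zero_lt_one' ℝ)
    (fun t _ => (h2 t).continuousAt.continuousWithinAt) (fun t _ => h2 t)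
  simp only [one_smul, zero_smul, add_zero, sub_zero, div_one] at hc'
  rw [← hc']
  have hop := (iteratedFDeriv ℝ 3 f (x + c • h) - iteratedFDeriv ℝ 3 f x).le_opNorm ![h, w, w]
  rw [sub_apply, iteratedFDeriv_three_apply, iteratedFDeriv_three_apply,
    Fin.prod_univ_three] at hop
  simp only [Matrix.cons_val_zero, Matrix.cons_val_one, Matrix.cons_val] at hop
  rw [← Real.norm_eq_abs]
  refine hop.trans ?_
  have h3 := hh (x + c • h) x
  have h4 : ‖x + c • h - x‖ ≤ ‖h‖ := by
    rw [add_sub_cancel_left, norm_smul, Real.norm_eq_abs, abs_of_pos hc.1]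
    exact mul_le_of_le_one_left hpos.le hc.2.le
  have h5 : ‖x + c • h - x‖ ^ ν ≤ ‖h‖ ^ ν := Real.rpow_le_rpow (norm_nonneg _) h4 hν
  have h6 := h3.trans (mul_le_mul_of_nonneg_left h5 hHf.le)
  calc _ ≤ Hf * ‖h‖ ^ ν * (‖h‖ * ‖w‖ * ‖w‖) := by gcongr
    _ = Hf * ‖h‖ ^ (1 + ν) * ‖w‖ ^ 2 := by
      rw [Real.rpow_add hpos, Real.rpow_one]
      ring

/-- The third derivative of a convex function is dominated by its second derivative and the
Hölder constant. -/
theorem abs_third_fderiv_le (hc : ConvexOn ℝ univ f) (hf : TimesDifferentiable 3 f) (hν : 0 ≤ ν)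
    (hHf : 0 < Hf) (hh : HolderDeriv 3 ν Hf f) {τ : ℝ} (hτ : 0 < τ) (x h w : E) :
    |fderiv ℝ (fderiv ℝ (fderiv ℝ f)) x h w w| ≤
      1 / τ * fderiv ℝ (fderiv ℝ f) x w w + τ ^ ν * Hf * (‖h‖ ^ (1 + ν) * ‖w‖ ^ 2) := by
  have key : ∀ h : E, -fderiv ℝ (fderiv ℝ (fderiv ℝ f)) x h w w ≤
      1 / τ * fderiv ℝ (fderiv ℝ f) x w w + τ ^ ν * Hf * (‖h‖ ^ (1 + ν) * ‖w‖ ^ 2) := by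
    intro h
    -- Convexity at the displaced point $x+\tau h$ bounds $-\tau D^3f(x)[h,w,w]$; then divide by
    -- $\tau$.
    have h1 := (abs_le.1 (abs_second_fderiv_sub_le hf hν hHf hh x (τ • h) w)).2
    have h2 := ConvexOn.second_fderiv_nonneg hc hf (x + τ • h) w
    rw [norm_smul, Real.norm_eq_abs, abs_of_pos hτ, Real.mul_rpow hτ.le (norm_nonneg _),
      Real.rpow_add hτ, Real.rpow_one] at h1
    simp only [map_smul, smul_apply, smul_eq_mul] at h1
    have h3 : τ * -fderiv ℝ (fderiv ℝ (fderiv ℝ f)) x h w w ≤ τ *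
      (1 / τ * fderiv ℝ (fderiv ℝ f) x w w + τ ^ ν * Hf * (‖h‖ ^ (1 + ν) * ‖w‖ ^ 2)) := by
      have : τ * (1 / τ * fderiv ℝ (fderiv ℝ f) x w w) = fderiv ℝ (fderiv ℝ f) x w w := by
        field_simp
      rw [mul_add, this]
      linarith
    exact le_of_mul_le_mul_left h3 hτ
  rw [abs_le']
  refine ⟨?_, key h⟩
  -- The third derivative is odd in `h`, while the bound is even.
  have := key (-h)
  simpa using this

end Derivatives

/-! ### Derivatives of the scaling function and the tensor model -/

section Model

theorem exists_hasFDerivAt_bilin {F : Type*} [NormedAddCommGroup F] [NormedSpace ℝ F]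
    (B : E →L[ℝ] E →L[ℝ] F) (x z : E) :
    ∃ l : E →L[ℝ] F, HasFDerivAt (fun y => B (y - x) (y - x)) l z ∧
      ∀ w, l w = B (z - x) w + B w (z - x) := by
  have hsub : HasFDerivAt (fun y : E => y - x) (ContinuousLinearMap.id ℝ E) z :=
    (hasFDerivAt_id z).sub_const x
  have hB : HasFDerivAt (fun y : E => B (y - x)) (B.comp (ContinuousLinearMap.id ℝ E)) z :=
    HasFDerivAt.comp z B.hasFDerivAt hsub
  exact ⟨_, hB.clm_apply hsub, fun w => by simp⟩

theorem exists_hasFDerivAt_trilin {F : Type*} [NormedAddCommGroup F] [NormedSpace ℝ F]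
    (T : E →L[ℝ] E →L[ℝ] E →L[ℝ] F) (x z : E) :
    ∃ l : E →L[ℝ] F, HasFDerivAt (fun y => T (y - x) (y - x) (y - x)) l z ∧
      ∀ w, l w = T (z - x) (z - x) w + T (z - x) w (z - x) + T w (z - x) (z - x) := by
  have hsub : HasFDerivAt (fun y : E => y - x) (ContinuousLinearMap.id ℝ E) z :=
    (hasFDerivAt_id z).sub_const x
  obtain ⟨l, hl, hl'⟩ := exists_hasFDerivAt_bilin T x z
  exact ⟨_, hl.clm_apply hsub, fun w => by
    simp only [add_apply, ContinuousLinearMap.comp_id, ContinuousLinearMap.flip_apply, hl',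
      add_assoc]⟩

theorem hasDerivAt_bilin_line {F : Type*} [NormedAddCommGroup F] [NormedSpace ℝ F]
    (B : E →L[ℝ] E →L[ℝ] F) (x u w a : E) (t : ℝ) :
    HasDerivAt (fun s : ℝ => B (u + s • w - x) a) (B w a) t := by
  have h : HasDerivAt (fun s : ℝ => B (u + s • w - x)) (B w) t :=
    B.hasFDerivAt.comp_hasDerivAt t (hasDerivAt_line u w x t)
  exact hasDerivAt_apply_const h a

theorem hasDerivAt_trilin_line {F : Type*} [NormedAddCommGroup F] [NormedSpace ℝ F]
    (T : E →L[ℝ] E →L[ℝ] E →L[ℝ] F) (x u w a : E) (t : ℝ) :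
    HasDerivAt (fun s : ℝ => T (u + s • w - x) (u + s • w - x) a)
      (T (u + t • w - x) w a + T w (u + t • w - x) a) t := by
  obtain ⟨l, hl, hl'⟩ := exists_hasFDerivAt_bilin T x (u + t • w)
  have hl2 : HasDerivAt (fun s : ℝ => u + s • w) w t := by
    simpa using ((hasDerivAt_id t).smul_const w).const_add u
  have h : HasDerivAt (fun s : ℝ => T (u + s • w - x) (u + s • w - x)) (l w) t :=
    HasFDerivAt.comp_hasDerivAt (l := fun y => T (y - x) (y - x)) t hl hl2
  have h' := hasDerivAt_apply_const h a
  rwa [hl', add_apply] at h'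

theorem exists_hasFDerivAt_norm_sub_rpow {q : ℝ} (hq : 0 ≤ q) (x z : E) :
    ∃ l : E →L[ℝ] ℝ, HasFDerivAt (fun y => ‖y - x‖ ^ (q + 2)) l z ∧
      ∀ w, l w = (q + 2) * (‖z - x‖ ^ q * inner ℝ (z - x) w) := by
  have hsub : HasFDerivAt (fun y : E => y - x) (ContinuousLinearMap.id ℝ E) z :=
    (hasFDerivAt_id z).sub_const x
  have h := hasFDerivAt_norm_rpow (z - x) (show 1 < q + 2 by linarith)
  refine ⟨_, HasFDerivAt.comp (g := fun y : E => ‖y‖ ^ (q + 2)) z h hsub, fun w => ?_⟩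
  simp [mul_assoc, inner_sub_left]

variable {f : E → ℝ} {ν Hf : ℝ}

theorem scaling_eq (f : E → ℝ) (x : E) (ν : ℝ) :
    scaling f x ν = fun y => 1 / 2 * fderiv ℝ (fderiv ℝ f) x (y - x) (y - x) +
      1 / (3 + ν) * ‖y - x‖ ^ (1 + ν + 2) := by
  funext y
  rw [scaling, iteratedFDeriv_two_apply, show 1 + ν + 2 = 3 + ν by ring]

theorem tensorModel_eq (f : E → ℝ) (x : E) (H ν : ℝ) :
    tensorModel f x 3 H ν = fun y => f x + fderiv ℝ f x (y - x) +
      1 / 2 * fderiv ℝ (fderiv ℝ f) x (y - x) (y - x) +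
      1 / 6 * fderiv ℝ (fderiv ℝ (fderiv ℝ f)) x (y - x) (y - x) (y - x) +
      H / 6 * ‖y - x‖ ^ (1 + ν + 2) := by
  funext y
  rw [tensorModel, taylorPoly, Finset.sum_range_succ, Finset.sum_range_succ,
    Finset.sum_range_succ, Finset.sum_range_one, iteratedFDeriv_two_apply,
    iteratedFDeriv_three_apply, iteratedFDeriv_one_apply, iteratedFDeriv_zero_apply,
    show 1 + ν + 2 = (3 : ℕ) + ν by push_cast; ring]
  norm_num [Nat.factorial]

theorem exists_hasFDerivAt_scaling (hf : TimesDifferentiable 3 f) (hν : 0 ≤ ν) (x z : E) :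
    ∃ l : E →L[ℝ] ℝ, HasFDerivAt (scaling f x ν) l z ∧ ∀ w, l w =
      fderiv ℝ (fderiv ℝ f) x (z - x) w + ‖z - x‖ ^ (1 + ν) * inner ℝ (z - x) w := by
  obtain ⟨l2, h2, h2'⟩ := exists_hasFDerivAt_bilin (fderiv ℝ (fderiv ℝ f) x) x z
  obtain ⟨l3, h3, h3'⟩ := exists_hasFDerivAt_norm_sub_rpow (q := 1 + ν) (by linarith) x z
  rw [scaling_eq]
  refine ⟨_, (h2.const_mul (1 / 2)).add (h3.const_mul (1 / (3 + ν))), fun w => ?_⟩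
  have : (3 + ν) ≠ 0 := by linarith
  simp only [add_apply, smul_apply, smul_eq_mul, h2', h3', hf.second_symm x w]
  field_simp
  ring

theorem exists_hasFDerivAt_tensorModel (hf : TimesDifferentiable 3 f) (hν : 0 ≤ ν) (H : ℝ)
    (x z : E) :
    ∃ l : E →L[ℝ] ℝ, HasFDerivAt (tensorModel f x 3 H ν) l z ∧ ∀ w, l w =
      fderiv ℝ f x w + fderiv ℝ (fderiv ℝ f) x (z - x) w +
      1 / 2 * fderiv ℝ (fderiv ℝ (fderiv ℝ f)) x (z - x) (z - x) w +
      (3 + ν) * H / 6 * (‖z - x‖ ^ (1 + ν) * inner ℝ (z - x) w) := by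
  obtain ⟨l2, h2, h2'⟩ := exists_hasFDerivAt_bilin (fderiv ℝ (fderiv ℝ f) x) x z
  obtain ⟨l3, h3, h3'⟩ := exists_hasFDerivAt_trilin (fderiv ℝ (fderiv ℝ (fderiv ℝ f)) x) x z
  obtain ⟨l4, h4, h4'⟩ := exists_hasFDerivAt_norm_sub_rpow (q := 1 + ν) (by linarith) x z
  have hsub : HasFDerivAt (fun y : E => y - x) (ContinuousLinearMap.id ℝ E) z :=
    (hasFDerivAt_id z).sub_const x
  have h1 : HasFDerivAt (fun y : E => f x + fderiv ℝ f x (y - x))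
      ((fderiv ℝ f x).comp (ContinuousLinearMap.id ℝ E)) z :=
    (HasFDerivAt.comp z (fderiv ℝ f x).hasFDerivAt hsub).const_add (f x)
  rw [tensorModel_eq]
  refine ⟨_, ((h1.add (h2.const_mul (1 / 2))).add (h3.const_mul (1 / 6))).add
    (h4.const_mul (H / 6)), fun w => ?_⟩
  have e1 := hf.third_symm_right x (z - x) w (z - x)
  have e2 := hf.third_symm_left x w (z - x)
  simp only [add_apply, smul_apply, smul_eq_mul, h2', h3', h4', hf.second_symm x w, e1, e2,
    ContinuousLinearMap.comp_id]
  ring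

theorem differentiable_scaling (hf : TimesDifferentiable 3 f) (hν : 0 ≤ ν) (x : E) :
    Differentiable ℝ (scaling f x ν) := fun z => by
  obtain ⟨l, hl, -⟩ := exists_hasFDerivAt_scaling hf hν x z
  exact hl.differentiableAt

theorem differentiable_tensorModel (hf : TimesDifferentiable 3 f) (hν : 0 ≤ ν) (H : ℝ) (x : E) :
    Differentiable ℝ (tensorModel f x 3 H ν) := fun z => by
  obtain ⟨l, hl, -⟩ := exists_hasFDerivAt_tensorModel hf hν H x z
  exact hl.differentiableAt

theorem fderiv_scaling_apply (hf : TimesDifferentiable 3 f) (hν : 0 ≤ ν) (x z w : E) :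
    fderiv ℝ (scaling f x ν) z w =
      fderiv ℝ (fderiv ℝ f) x (z - x) w + ‖z - x‖ ^ (1 + ν) * inner ℝ (z - x) w := by
  obtain ⟨l, hl, h⟩ := exists_hasFDerivAt_scaling hf hν x z
  rw [hl.fderiv, h]

theorem fderiv_tensorModel_apply (hf : TimesDifferentiable 3 f) (hν : 0 ≤ ν) (H : ℝ) (x z w : E) :
    fderiv ℝ (tensorModel f x 3 H ν) z w =
      fderiv ℝ f x w + fderiv ℝ (fderiv ℝ f) x (z - x) w +
      1 / 2 * fderiv ℝ (fderiv ℝ (fderiv ℝ f)) x (z - x) (z - x) w +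
      (3 + ν) * H / 6 * (‖z - x‖ ^ (1 + ν) * inner ℝ (z - x) w) := by
  obtain ⟨l, hl, h⟩ := exists_hasFDerivAt_tensorModel hf hν H x z
  rw [hl.fderiv, h]

/-- The second derivatives along a line of the scaling function and of the tensor model. -/
theorem exists_second_deriv_line (hf : TimesDifferentiable 3 f) (hν : 0 ≤ ν) (H : ℝ)
    (x u w : E) (t : ℝ) :
    ∃ c, ‖u + t • w - x‖ ^ (1 + ν) * ‖w‖ ^ 2 ≤ c ∧
      c ≤ (2 + ν) * ‖u + t • w - x‖ ^ (1 + ν) * ‖w‖ ^ 2 ∧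
      HasDerivAt (fun s : ℝ => fderiv ℝ (scaling f x ν) (u + s • w) w)
        (fderiv ℝ (fderiv ℝ f) x w w + c) t ∧
      HasDerivAt (fun s : ℝ => fderiv ℝ (tensorModel f x 3 H ν) (u + s • w) w)
        (fderiv ℝ (fderiv ℝ f) x w w +
          fderiv ℝ (fderiv ℝ (fderiv ℝ f)) x (u + t • w - x) w w + (3 + ν) * H / 6 * c) t := by
  -- The same `c`, the second derivative of $\|\cdot-x\|^{3+\nu}/(3+\nu)$, enters both functions;
  -- this is what makes them comparable.
  obtain ⟨c, hc, hc1, hc2⟩ :=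
    exists_hasDerivAt_norm_rpow_mul_inner (q := 1 + ν) (by linarith) u w x t
  refine ⟨c, hc1, by linarith, ?_, ?_⟩
  all_goals
    have h2 := hasDerivAt_bilin_line (fderiv ℝ (fderiv ℝ f) x) x u w w t
  · simp only [fderiv_scaling_apply hf hν]
    exact h2.add hc
  · simp only [fderiv_tensorModel_apply hf hν]
    have h3 := hasDerivAt_trilin_line (fderiv ℝ (fderiv ℝ (fderiv ℝ f)) x) x u w w t
    rw [hf.third_symm_left x w] at h3
    exact (((h2.const_add (fderiv ℝ f x w)).add (h3.const_mul (1 / 2))).add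
      (hc.const_mul ((3 + ν) * H / 6))).congr_deriv (by ring)

end Model

/-! ### From second derivatives to Bregman distances -/

section RelativeBounds

variable {d g : E → ℝ}

/-- A linear combination of two Bregman distances is nonnegative if the same combination of the
second derivatives along the connecting segment is. -/
theorem combination_bregman_nonneg (hd : Differentiable ℝ d) (hg : Differentiable ℝ g) (α β : ℝ)
    (u v : E)
    (h : ∀ t ∈ Icc (0 : ℝ) 1, ∃ a b,
      HasDerivAt (fun s : ℝ => fderiv ℝ d (u + s • (v - u)) (v - u)) a t ∧
      HasDerivAt (fun s : ℝ => fderiv ℝ g (u + s • (v - u)) (v - u)) b t ∧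
      0 ≤ α * a + β * b) :
    0 ≤ α * bregman d u v + β * bregman g u v := by
  have key := tangent_le_of_second_deriv_nonneg
    (φ := fun t : ℝ => α * d (u + t • (v - u)) + β * g (u + t • (v - u)))
    (φ' := fun t : ℝ => α * fderiv ℝ d (u + t • (v - u)) (v - u) +
      β * fderiv ℝ g (u + t • (v - u)) (v - u))
    (fun t => ((hasDerivAt_comp_line hd u (v - u) t).const_mul α).add
      ((hasDerivAt_comp_line hg u (v - u) t).const_mul β))
    (fun t ht => by
      obtain ⟨a, b, ha, hb, hab⟩ := h t ht
      exact ⟨_, hab, (ha.const_mul α).add (hb.const_mul β)⟩)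
  simp only [zero_smul, one_smul, add_zero, add_sub_cancel] at key
  rw [bregman, bregman]
  linarith

/-- A bound on the second derivative along a segment bounds the Bregman distance. -/
theorem bregman_le_of_second_deriv_le (hg : Differentiable ℝ g) (K : ℝ) (u v : E)
    (h : ∀ t ∈ Icc (0 : ℝ) 1, ∃ b, b ≤ K ∧
      HasDerivAt (fun s : ℝ => fderiv ℝ g (u + s • (v - u)) (v - u)) b t) :
    bregman g u v ≤ K / 2 := by
  have key := tangent_le_of_second_deriv_nonneg
    (φ := fun t : ℝ => K / 2 * t ^ 2 - g (u + t • (v - u)))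
    (φ' := fun t : ℝ => K * t - fderiv ℝ g (u + t • (v - u)) (v - u))
    (fun t => (((hasDerivAt_pow 2 t).const_mul (K / 2)).sub
      (hasDerivAt_comp_line hg u (v - u) t)).congr_deriv (by norm_num; ring))
    (fun t ht => by
      obtain ⟨b, hbK, hb⟩ := h t ht
      exact ⟨K - b, by linarith, (((hasDerivAt_id t).const_mul K).sub hb).congr_deriv (by ring)⟩)
  simp only [zero_smul, one_smul, add_zero, add_sub_cancel] at key
  rw [bregman]
  linarith

end RelativeBounds

/-! ### Adaptive Bregman gradient method for a general pair $(g,d)$ -/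

section BregmanMethod

variable {d g : E → ℝ}

/-- Stationarity of the unconstrained minimizer, $\nabla g(u)+c(\nabla d(p)-\nabla d(u))=0$, turns
the three-point relation into an equality; convexity of `d` plays no role. -/
theorem prox_three_point (hd : Differentiable ℝ d) {u p : E} {c : ℝ}
    (hp : IsMinOn (proxObjective g d u c) univ p) (z : E) :
    fderiv ℝ g u (z - u) + c * bregman d u z =
      fderiv ℝ g u (p - u) + c * bregman d u p + c * bregman d p z := by
  have hder : HasFDerivAt (proxObjective g d u c)
      (fderiv ℝ g u + c • (fderiv ℝ d p - fderiv ℝ d u)) p := by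
    have h1 : ∀ l : E →L[ℝ] ℝ, HasFDerivAt (fun z : E => l (z - u)) l p := fun l =>
      (HasFDerivAt.comp p l.hasFDerivAt ((hasFDerivAt_id p).sub_const u))
    exact (h1 (fderiv ℝ g u)).add
      ((((hd p).hasFDerivAt.sub_const (d u)).sub (h1 (fderiv ℝ d u))).const_mul c)
  have h0 := (hp.isLocalMin univ_mem).hasFDerivAt_eq_zero hder
  have h1 := congrArg (fun l : E →L[ℝ] ℝ => l (z - p)) h0
  simp only [add_apply, smul_apply, sub_apply, zero_apply, smul_eq_mul, map_sub] at h1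
  simp only [bregman, map_sub]
  linarith

/-- One step of the adaptive Bregman gradient method. -/
theorem GeneratedByBregmanMethod.step (hd : Differentiable ℝ d) {μ Lh M L₀ : ℝ}
    (hL₀ : 0 < L₀) (hnonneg : ∀ u v, 0 ≤ bregman d u v)
    (hlow : ∀ u v, μ * bregman d u v ≤ bregman g u v)
    (hup : ∀ u v, bregman g u v ≤ Lh * bregman d u v)
    (hM₀ : 2 * L₀ ≤ M) (hML : 4 * Lh ≤ M) {y₀ : E} {y : ℕ → E}
    (hy : GeneratedByBregmanMethod g d y₀ L₀ y) (k : ℕ) :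
    ∃ c, 0 < c ∧ c ≤ M ∧ ∀ z, g (y (k + 1)) + c * bregman d (y (k + 1)) z ≤
      g z + (c - μ) * bregman d (y k) z := by
  obtain ⟨L, i, trial, hy0, hL0, hstep⟩ := hy
  -- If the counter is positive, the preceding trial was rejected, so its constant is below `Lh` and
  -- the accepted one is below `2 * Lh`. Halving afterwards preserves `L k ≤ M / 2`.
  have htest : ∀ k, 0 < L k → L k ≤ M / 2 → 2 ^ i k * L k ≤ M / 2 := by
    intro k hpos hle
    obtain ⟨-, hrej, -, -, -⟩ := hstep k
    rcases Nat.eq_zero_or_pos (i k) with h0 | hi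
    · simpa [h0] using hle
    · have hlt : i k - 1 < i k := by omega
      have h := hrej (i k - 1) hlt
      have hsmall : 2 ^ (i k - 1) * L k < Lh := by
        by_contra! hcon
        apply h
        have h1 := hup (y k) (trial k (i k - 1))
        have h2 := mul_le_mul_of_nonneg_right hcon (hnonneg (y k) (trial k (i k - 1)))
        rw [bregman] at h1
        rw [Accepted]
        linarith
      have : (2 : ℝ) ^ i k = 2 * 2 ^ (i k - 1) := by
        rw [← pow_succ']
        congr 1
        omega
      rw [this]
      linarith
  have hLk : ∀ k, 0 < L k ∧ L k ≤ M / 2 := by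
    intro k
    induction k with
    | zero => exact ⟨by rw [hL0]; exact hL₀, by rw [hL0]; linarith⟩
    | succ k ih =>
      have h1 := htest k ih.1 ih.2
      obtain ⟨-, -, -, -, hL⟩ := hstep k
      have h2 : L (k + 1) = 2 ^ i k * L k / 2 := by
        rw [hL, zpow_sub₀ (by norm_num), zpow_natCast, zpow_one]
        ring
      have h3 : 0 < (2 : ℝ) ^ i k * L k := mul_pos (by positivity) ih.1
      rw [h2]
      constructor <;> linarith
  have hpos : 0 < (2 : ℝ) ^ i k * L k := mul_pos (by positivity) (hLk k).1
  refine ⟨2 ^ i k * L k, hpos, ?_, fun z => ?_⟩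
  · have := htest k (hLk k).1 (hLk k).2
    linarith
  · obtain ⟨hmin, -, hacc, hyk, -⟩ := hstep k
    have h3 := prox_three_point hd (hmin (i k) le_rfl) z
    have h4 := hlow (y k) z
    rw [Accepted] at hacc
    rw [hyk]
    have h5 : bregman g (y k) z = g z - g (y k) - fderiv ℝ g (y k) (z - y k) := rfl
    rw [h5] at h4
    linarith

/-- Take `z = y k` in the step inequality, where the Bregman term on the right vanishes. -/
theorem GeneratedByBregmanMethod.antitone {y : ℕ → E} {μ M : ℝ}
    (hnonneg : ∀ u v, 0 ≤ bregman d u v)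
    (hstep : ∀ k, ∃ c, 0 < c ∧ c ≤ M ∧ ∀ z, g (y (k + 1)) + c * bregman d (y (k + 1)) z ≤
      g z + (c - μ) * bregman d (y k) z) : Antitone fun k => g (y k) := by
  refine antitone_nat_of_succ_le fun k => ?_
  obtain ⟨c, hc, -, h⟩ := hstep k
  have h1 := h (y k)
  have h2 := mul_nonneg hc.le (hnonneg (y (k + 1)) (y k))
  have h3 : bregman d (y k) (y k) = 0 := by simp [bregman]
  rw [h3] at h1
  linarith

/-- Linear convergence of the Bregman gradient method under relative strong convexity. -/
theorem GeneratedByBregmanMethod.gap_mul_le {y : ℕ → E} {μ M : ℝ} (hμ : 0 < μ) (hμM : μ < M)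
    (hnonneg : ∀ u v, 0 ≤ bregman d u v)
    (hstep : ∀ k, ∃ c, 0 < c ∧ c ≤ M ∧ ∀ z, g (y (k + 1)) + c * bregman d (y (k + 1)) z ≤
      g z + (c - μ) * bregman d (y k) z)
    {z : E} (hz : ∀ v, g z ≤ g v) (n : ℕ) :
    (g (y n) - g z) * ((M / (M - μ)) ^ n - 1) ≤ μ * bregman d (y 0) z := by
  have hMμ : 0 < M - μ := by linarith
  have hM : 0 < M := by linarith
  have hanti := GeneratedByBregmanMethod.antitone hnonneg hstep
  have hr1 : 1 ≤ M / (M - μ) := by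
    rw [le_div_iff₀ hMμ]
    linarith
  -- Potential carrying both the weighted distance and the gap; $r^n-1$ is the geometric sum of the
  -- weights, up to the factor $M/\mu$.
  have key : ∀ n, μ * ((M / (M - μ)) ^ n * bregman d (y n) z) +
      (g (y n) - g z) * ((M / (M - μ)) ^ n - 1) ≤ μ * bregman d (y 0) z := by
    intro n
    induction n with
    | zero => simp
    | succ n ih =>
      obtain ⟨c, hc, hcM, h⟩ := hstep n
      have h1 := h z
      have hG : 0 ≤ g (y (n + 1)) - g z := sub_nonneg.2 (hz _)
      have hG' : g (y (n + 1)) ≤ g (y n) := hanti n.le_succ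
      have hD := hnonneg (y n) z
      -- The varying `c` may be replaced by `M` because the gap and the Bregman distance to the
      -- minimizer are nonnegative.
      have h2 : g (y (n + 1)) - g z + M * bregman d (y (n + 1)) z ≤
          (M - μ) * bregman d (y n) z := by
        have h3 : c * (g (y (n + 1)) - g z + M * bregman d (y (n + 1)) z) ≤
            c * ((M - μ) * bregman d (y n) z) := by
          have h4 := mul_le_mul_of_nonneg_left h1 hM.le
          have h5 := mul_le_mul_of_nonneg_right hcM hG
          have h6 := mul_le_mul_of_nonneg_right hcM (mul_nonneg hμ.le hD)
          nlinarith
        exact le_of_mul_le_mul_left h3 hc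
      set r := M / (M - μ) with hr
      have hrM : r * (M - μ) = M := div_mul_cancel₀ _ hMμ.ne'
      have hrn : 1 ≤ r ^ n := one_le_pow₀ hr1
      have h7 : r ^ n * r * (g (y (n + 1)) - g z + M * bregman d (y (n + 1)) z) ≤
          r ^ n * M * bregman d (y n) z := by
        have := mul_le_mul_of_nonneg_left h2 (by positivity : 0 ≤ r ^ n * r)
        calc _ ≤ _ := this
          _ = r ^ n * (r * (M - μ)) * bregman d (y n) z := by ring
          _ = _ := by rw [hrM]
      -- Monotonicity lets the newest gap replace the earlier one.
      have h8 := mul_le_mul_of_nonneg_right hG' (sub_nonneg.2 hrn)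
      have h9 : M * (μ * (r ^ (n + 1) * bregman d (y (n + 1)) z) +
          (g (y (n + 1)) - g z) * (r ^ (n + 1) - 1)) ≤ M * (μ * bregman d (y 0) z) := by
        rw [pow_succ]
        have h10 : (r ^ n * r) * (g (y (n + 1)) - g z) * (M - μ) =
            r ^ n * M * (g (y (n + 1)) - g z) := by
          calc _ = r ^ n * (r * (M - μ)) * (g (y (n + 1)) - g z) := by ring
            _ = _ := by rw [hrM]
        have h11 := mul_le_mul_of_nonneg_left h7 hμ.le
        have h12 := mul_le_mul_of_nonneg_left ih hM.le
        have h13 := mul_le_mul_of_nonneg_left h8 hM.le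
        linarith
      exact le_of_mul_le_mul_left h9 hM
  have h1 := key n
  have h2 : 0 ≤ μ * ((M / (M - μ)) ^ n * bregman d (y n) z) :=
    mul_nonneg hμ.le (mul_nonneg (by positivity) (hnonneg _ _))
  linarith

end BregmanMethod

/-! ### The constants $\tau_H$, $\mu_H$, $L_H$ -/

section Constants

variable {ν H Hf : ℝ}

/-- The defining balance of $\tau_H$: the right side is the coefficient of the regularizer's Hessian
in the model. -/
theorem tauH_rpow (hν0 : 0 ≤ ν) (hHf : 0 < Hf) (hH : 6 / (3 + ν) * Hf < H) :
    tauH ν H Hf ^ (1 + ν) * Hf = (3 + ν) * H / 6 := by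
  have hH0 : 0 < H := lt_trans (by positivity) hH
  rw [tauH, ← Real.rpow_mul (by positivity), one_div, inv_mul_cancel₀ (by linarith),
    Real.rpow_one]
  field_simp

theorem holder_lt_of_lt (hν0 : 0 ≤ ν) (hH : 6 / (3 + ν) * Hf < H) : Hf < (3 + ν) * H / 6 := by
  rw [div_mul_eq_mul_div, div_lt_iff₀ (by linarith)] at hH
  linarith

theorem one_lt_tauH (hν0 : 0 ≤ ν) (hHf : 0 < Hf) (hH : 6 / (3 + ν) * Hf < H) :
    1 < tauH ν H Hf := by
  have h := holder_lt_of_lt hν0 hH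
  refine Real.one_lt_rpow ?_ (by positivity)
  rw [lt_div_iff₀ (by positivity)]
  linarith

theorem muH_pos (hν0 : 0 ≤ ν) (hHf : 0 < Hf) (hH : 6 / (3 + ν) * Hf < H) : 0 < muH ν H Hf := by
  have h := one_lt_tauH hν0 hHf hH
  have h1 : 0 < tauH ν H Hf := by linarith
  have h2 : 0 < tauH ν H Hf - 1 := by linarith
  exact lt_min (div_pos h2 h1) (by positivity)

theorem muH_lt_one (hν0 : 0 ≤ ν) (hHf : 0 < Hf) (hH : 6 / (3 + ν) * Hf < H) :
    muH ν H Hf < 1 := by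
  have h := one_lt_tauH hν0 hHf hH
  refine (min_le_left _ _).trans_lt ?_
  rw [div_lt_one (by linarith)]
  linarith

theorem one_le_smoothH (hν0 : 0 ≤ ν) (hHf : 0 < Hf) (hH : 6 / (3 + ν) * Hf < H) :
    1 ≤ smoothH ν H Hf := by
  have h := one_lt_tauH hν0 hHf hH
  refine le_trans ?_ (le_max_left _ _)
  rw [le_div_iff₀ (by linarith)]
  linarith

end Constants

/-! ### Relative bounds, majorization and size estimates for the model -/

section Model

variable {f : E → ℝ} {ν Hf H : ℝ}

theorem second_fderiv_le (f : E → ℝ) (x w : E) :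
    fderiv ℝ (fderiv ℝ f) x w w ≤ ‖iteratedFDeriv ℝ 2 f x‖ * ‖w‖ ^ 2 := by
  have h := (iteratedFDeriv ℝ 2 f x).le_opNorm ![w, w]
  rw [iteratedFDeriv_two_apply, Fin.prod_univ_two] at h
  simp only [Matrix.cons_val_zero, Matrix.cons_val_one] at h
  rw [pow_two]
  exact (le_abs_self _).trans h

/-- Relative bounds for the second derivatives of the tensor model along a line. -/
theorem exists_second_deriv_bounds (hν0 : 0 ≤ ν) (hc : ConvexOn ℝ univ f)
    (hf : TimesDifferentiable 3 f) (hHf : 0 < Hf) (hh : HolderDeriv 3 ν Hf f)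
    (hH : 6 / (3 + ν) * Hf < H) (x u w : E) (t : ℝ) :
    ∃ a b, HasDerivAt (fun s : ℝ => fderiv ℝ (scaling f x ν) (u + s • w) w) a t ∧
      HasDerivAt (fun s : ℝ => fderiv ℝ (tensorModel f x 3 H ν) (u + s • w) w) b t ∧
      0 ≤ a ∧ muH ν H Hf * a ≤ b ∧ b ≤ smoothH ν H Hf * a ∧
      a ≤ (‖iteratedFDeriv ℝ 2 f x‖ + (2 + ν) * ‖u + t • w - x‖ ^ (1 + ν)) * ‖w‖ ^ 2 := by
  obtain ⟨c, hc1, hc2, ha, hb⟩ := exists_second_deriv_line hf hν0 H x u w t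
  have hτ := one_lt_tauH hν0 hHf hH
  have hτ0 : 0 < tauH ν H Hf := by linarith
  have hpow : (3 + ν) * H / 6 = tauH ν H Hf ^ ν * tauH ν H Hf * Hf := by
    rw [← tauH_rpow hν0 hHf hH, Real.rpow_add hτ0, Real.rpow_one]
    ring
  have h3 := abs_le.1 (abs_third_fderiv_le hc hf hν0 hHf hh hτ0 x (u + t • w - x) w)
  have h2 := ConvexOn.second_fderiv_nonneg hc hf x w
  have h2' := second_fderiv_le f x w
  have hc0 : 0 ≤ c := le_trans (by positivity) hc1
  have hκ : 0 ≤ tauH ν H Hf ^ ν * Hf := by positivity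
  have hc3 := mul_le_mul_of_nonneg_left hc1 hκ
  refine ⟨_, _, ha, hb, by linarith, ?_, ?_, by linarith⟩
  -- Compare the coefficients of $D^2f(x)[w,w]$ and of `c` separately; `hc3` absorbs
  -- $\|h\|^{1+\nu}\|w\|^2$ into `c`.
  · have e1 : muH ν H Hf ≤ 1 - 1 / tauH ν H Hf := by
      refine (min_le_left _ _).trans_eq ?_
      field_simp
    have e2 : muH ν H Hf ≤ tauH ν H Hf ^ ν * (tauH ν H Hf - 1) * Hf := min_le_right _ _
    have e3 := mul_le_mul_of_nonneg_right e1 h2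
    have e4 := mul_le_mul_of_nonneg_right e2 hc0
    rw [hpow]
    linarith [h3.1]
  · have e1 : 1 + 1 / tauH ν H Hf ≤ smoothH ν H Hf := by
      refine le_trans (le_of_eq ?_) (le_max_left _ _)
      field_simp
    have e2 : tauH ν H Hf ^ ν * (tauH ν H Hf + 1) * Hf ≤ smoothH ν H Hf := le_max_right _ _
    have e3 := mul_le_mul_of_nonneg_right e1 h2
    have e4 := mul_le_mul_of_nonneg_right e2 hc0
    rw [hpow]
    linarith [h3.2]

theorem bregman_scaling_nonneg (hν0 : 0 ≤ ν) (hc : ConvexOn ℝ univ f)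
    (hf : TimesDifferentiable 3 f) (hHf : 0 < Hf) (hh : HolderDeriv 3 ν Hf f) (x u v : E) :
    0 ≤ bregman (scaling f x ν) u v := by
  have h := combination_bregman_nonneg (differentiable_scaling hf hν0 x)
    (differentiable_scaling hf hν0 x) 1 0 u v (fun t _ => by
      -- The scaling function does not involve `H`; any admissible value serves.
      obtain ⟨a, b, ha, -, ha0, -⟩ := exists_second_deriv_bounds (H := 6 / (3 + ν) * Hf + 1)
        hν0 hc hf hHf hh (by linarith) x u (v - u) t
      exact ⟨a, a, ha, ha, by linarith⟩)
  linarith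

theorem muH_mul_bregman_le (hν0 : 0 ≤ ν) (hc : ConvexOn ℝ univ f)
    (hf : TimesDifferentiable 3 f) (hHf : 0 < Hf) (hh : HolderDeriv 3 ν Hf f)
    (hH : 6 / (3 + ν) * Hf < H) (x u v : E) :
    muH ν H Hf * bregman (scaling f x ν) u v ≤ bregman (tensorModel f x 3 H ν) u v := by
  have h := combination_bregman_nonneg (differentiable_scaling hf hν0 x)
    (differentiable_tensorModel hf hν0 H x) (-muH ν H Hf) 1 u v (fun t _ => by
      obtain ⟨a, b, ha, hb, -, h1, -⟩ :=
        exists_second_deriv_bounds hν0 hc hf hHf hh hH x u (v - u) t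
      exact ⟨a, b, ha, hb, by linarith⟩)
  linarith

theorem bregman_le_smoothH_mul (hν0 : 0 ≤ ν) (hc : ConvexOn ℝ univ f)
    (hf : TimesDifferentiable 3 f) (hHf : 0 < Hf) (hh : HolderDeriv 3 ν Hf f)
    (hH : 6 / (3 + ν) * Hf < H) (x u v : E) :
    bregman (tensorModel f x 3 H ν) u v ≤ smoothH ν H Hf * bregman (scaling f x ν) u v := by
  have h := combination_bregman_nonneg (differentiable_scaling hf hν0 x)
    (differentiable_tensorModel hf hν0 H x) (smoothH ν H Hf) (-1) u v (fun t _ => by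
      obtain ⟨a, b, ha, hb, -, -, h1, -⟩ :=
        exists_second_deriv_bounds hν0 hc hf hHf hh hH x u (v - u) t
      exact ⟨a, b, ha, hb, by linarith⟩)
  linarith

theorem tensorModel_self (hν0 : 0 ≤ ν) (x : E) : tensorModel f x 3 H ν x = f x := by
  simp [tensorModel_eq, Real.zero_rpow (by linarith : 1 + ν + 2 ≠ 0)]

/-- The tensor model majorizes the function. -/
theorem le_tensorModel (hν0 : 0 ≤ ν) (hf : TimesDifferentiable 3 f) (hHf : 0 < Hf)
    (hh : HolderDeriv 3 ν Hf f) (hH : 6 / (3 + ν) * Hf < H) (x y : E) :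
    f y ≤ tensorModel f x 3 H ν y := by
  -- Both functions share value and gradient at `x`, so comparing second derivatives along the
  -- segment from `x` suffices.
  have h := combination_bregman_nonneg hf.differentiable
    (differentiable_tensorModel hf hν0 H x) (-1) 1 x y (fun t _ => by
      obtain ⟨c, hc1, -, -, hb⟩ := exists_second_deriv_line hf hν0 H x x (y - x) t
      refine ⟨_, _, hasDerivAt_fderiv_line hf.differentiable_fderiv x (y - x) (y - x) t, hb, ?_⟩
      rw [add_sub_cancel_left] at hc1 ⊢
      have h1 := (abs_le.1 (abs_second_fderiv_sub_le hf hν0 hHf hh x (t • (y - x)) (y - x))).2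
      have h2 := mul_le_mul_of_nonneg_left hc1 hHf.le
      have h3 := mul_le_mul_of_nonneg_right (holder_lt_of_lt hν0 hH).le
        (le_trans (by positivity) hc1)
      linarith)
  have hd : fderiv ℝ (tensorModel f x 3 H ν) x (y - x) = fderiv ℝ f x (y - x) := by
    simp [fderiv_tensorModel_apply hf hν0]
  rw [bregman, bregman, hd, tensorModel_self hν0] at h
  linarith

/-- Where $f(v)>f(x_0)$, majorization gives $\Omega(v)>f(x_0)\ge f(x)=\Omega(x)$, so a minimizer
over the compact ball is global. -/
theorem exists_tensorModel_minimizer [FiniteDimensional ℝ E] (hν0 : 0 ≤ ν)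
    (hf : TimesDifferentiable 3 f) (hHf : 0 < Hf) (hh : HolderDeriv 3 ν Hf f)
    (hH : 6 / (3 + ν) * Hf < H) {x x₀ c : E} {R : ℝ} (hx : f x ≤ f x₀)
    (hR : ∀ y, f y ≤ f x₀ → ‖y - c‖ ≤ R) :
    ∃ z, ∀ v, tensorModel f x 3 H ν z ≤ tensorModel f x 3 H ν v := by
  have hxR : x ∈ Metric.closedBall c R := by
    rw [mem_closedBall_iff_norm]
    exact hR x hx
  obtain ⟨z, -, hz⟩ := (isCompact_closedBall c R).exists_isMinOn ⟨x, hxR⟩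
    (differentiable_tensorModel hf hν0 H x).continuous.continuousOn
  refine ⟨z, fun v => ?_⟩
  by_cases hv : f v ≤ f x₀
  · exact hz (mem_closedBall_iff_norm.2 (hR v hv))
  · have h1 := le_tensorModel hν0 hf hHf hh hH x v
    have h2 : tensorModel f x 3 H ν z ≤ tensorModel f x 3 H ν x := hz hxR
    rw [tensorModel_self hν0] at h2
    linarith

theorem second_deriv_factor_le {R r D : ℝ} (hν0 : 0 ≤ ν) (hν1 : ν ≤ 1) (hR : 1 ≤ R) (hr0 : 0 ≤ r)
    (hr : r ≤ R) : D + (2 + ν) * r ^ (1 + ν) ≤ D + 3 * R ^ 2 := by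
  have h1 : r ^ (1 + ν) ≤ R ^ (2 : ℝ) :=
    (Real.rpow_le_rpow hr0 hr (by linarith)).trans
      (Real.rpow_le_rpow_of_exponent_le hR (by linarith))
  rw [Real.rpow_two] at h1
  have h2 : 0 ≤ r ^ (1 + ν) := by positivity
  nlinarith

/-- Within $2R$ of $x$ the curvature is at most $\|D^2f(x)\|+3(2R)^2=N_x$, so the distance is at
most $2R^2N_x$; finally $12R^2\le N_x$. -/
theorem bregman_scaling_le (hν0 : 0 ≤ ν) (hν1 : ν ≤ 1) (hc : ConvexOn ℝ univ f)
    (hf : TimesDifferentiable 3 f) (hHf : 0 < Hf) (hh : HolderDeriv 3 ν Hf f) {R : ℝ} (hR : 1 ≤ R)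
    {x z : E} (hz : ‖z - x‖ ≤ 2 * R) :
    bregman (scaling f x ν) x z ≤ bigNx f x R ^ 2 / 6 := by
  have h := bregman_le_of_second_deriv_le (differentiable_scaling hf hν0 x)
    (bigNx f x R * (2 * R) ^ 2) x z (fun t ht => by
      obtain ⟨a, b, ha, -, -, -, -, h1⟩ := exists_second_deriv_bounds (H := 6 / (3 + ν) * Hf + 1)
        hν0 hc hf hHf hh (by linarith) x x (z - x) t
      refine ⟨a, h1.trans ?_, ha⟩
      have hle : ‖x + t • (z - x) - x‖ ≤ 2 * R := by
        rw [add_sub_cancel_left, norm_smul, Real.norm_eq_abs, abs_of_nonneg ht.1]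
        exact (mul_le_of_le_one_left (norm_nonneg _) ht.2).trans hz
      have h2 := second_deriv_factor_le (D := ‖iteratedFDeriv ℝ 2 f x‖) hν0 hν1
        (by linarith : 1 ≤ 2 * R) (norm_nonneg _) hle
      have h3 : ‖iteratedFDeriv ℝ 2 f x‖ + 3 * (2 * R) ^ 2 = bigNx f x R := by
        rw [bigNx]
        ring
      rw [h3] at h2
      have h4 : 0 ≤ bigNx f x R := by
        rw [bigNx]
        positivity
      gcongr)
  have h1 : 12 * R ^ 2 ≤ bigNx f x R := by
    rw [bigNx]
    linarith [norm_nonneg (iteratedFDeriv ℝ 2 f x)]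
  have h2 : 0 ≤ bigNx f x R := le_trans (by positivity) h1
  nlinarith

/-- A point with large gradient has a large functional gap. -/
theorem gap_ge_of_norm_fderiv_gt (hν0 : 0 ≤ ν) (hν1 : ν ≤ 1) (hc : ConvexOn ℝ univ f)
    (hf : TimesDifferentiable 3 f) (hHf : 0 < Hf) (hh : HolderDeriv 3 ν Hf f)
    (hH : 6 / (3 + ν) * Hf < H) {R ε : ℝ} (hR : 1 ≤ R) (hε0 : 0 < ε) (hε1 : ε < 1) {x p z : E}
    (hp : ‖p - x‖ ≤ 2 * R) (hz : ∀ v, tensorModel f x 3 H ν z ≤ tensorModel f x 3 H ν v)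
    (hgrad : ε < ‖fderiv ℝ (tensorModel f x 3 H ν) p‖) :
    ε ^ 2 / (6 * (smoothH ν H Hf * bigNx f x R)) ≤
      tensorModel f x 3 H ν p - tensorModel f x 3 H ν z := by
  obtain ⟨v, hv1, hv⟩ : ∃ v : E, ‖v‖ ≤ 1 ∧ fderiv ℝ (tensorModel f x 3 H ν) p v ≤ -ε := by
    obtain ⟨v, hv1, hv⟩ := (fderiv ℝ (tensorModel f x 3 H ν) p).exists_lt_apply_of_lt_opNorm hgrad
    rw [Real.norm_eq_abs] at hv
    rcases lt_abs.1 hv with h | h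
    · exact ⟨-v, by rw [norm_neg]; exact hv1.le, by rw [map_neg]; linarith⟩
    · exact ⟨v, hv1.le, by linarith⟩
  have hL := one_le_smoothH hν0 hHf hH
  have hN : 12 * R ^ 2 ≤ bigNx f x R := by
    rw [bigNx]
    linarith [norm_nonneg (iteratedFDeriv ℝ 2 f x)]
  have hN12 : 12 ≤ bigNx f x R := by nlinarith
  set A := smoothH ν H Hf * bigNx f x R with hA
  have hA12 : 12 ≤ A := by nlinarith
  -- This minimizes $-t\epsilon+\frac32At^2$, with value $-\epsilon^2/(6A)$. Since $t_0\le1\le R$,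
  -- the step stays within $3R$ of $x$, where the curvature of $\rho_x$ is at most $3N_x$.
  set t₀ := ε / (3 * A) with ht₀
  have ht0 : 0 < t₀ := by positivity
  have ht1 : t₀ ≤ 1 := by
    rw [ht₀, div_le_one (by positivity)]
    linarith
  have hnorm : ‖t₀ • v‖ ≤ t₀ := by
    rw [norm_smul, Real.norm_eq_abs, abs_of_pos ht0]
    exact mul_le_of_le_one_right ht0.le hv1
  have hB := bregman_le_of_second_deriv_le (differentiable_tensorModel hf hν0 H x)
    (3 * A * t₀ ^ 2) p (p + t₀ • v) (fun t ht => by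
      obtain ⟨a, b, -, hb, -, -, h1, h2⟩ :=
        exists_second_deriv_bounds hν0 hc hf hHf hh hH x p (p + t₀ • v - p) t
      refine ⟨b, h1.trans ?_, hb⟩
      rw [add_sub_cancel_left] at h2
      have hle : ‖p + t • t₀ • v - x‖ ≤ 3 * R := by
        have e : p + t • t₀ • v - x = (p - x) + t • t₀ • v := by abel
        have e1 : ‖t • t₀ • v‖ ≤ 1 := by
          rw [norm_smul, Real.norm_eq_abs, abs_of_nonneg ht.1]
          exact (mul_le_of_le_one_left (norm_nonneg _) ht.2).trans (hnorm.trans ht1)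
        rw [e]
        linarith [norm_add_le (p - x) (t • t₀ • v)]
      have h3 := second_deriv_factor_le (D := ‖iteratedFDeriv ℝ 2 f x‖) hν0 hν1
        (by linarith : 1 ≤ 3 * R) (norm_nonneg _) hle
      have h4 : ‖iteratedFDeriv ℝ 2 f x‖ + 3 * (3 * R) ^ 2 ≤ 3 * bigNx f x R := by
        rw [bigNx]
        nlinarith [norm_nonneg (iteratedFDeriv ℝ 2 f x)]
      have h5 : a ≤ 3 * bigNx f x R * t₀ ^ 2 := by
        refine h2.trans ?_
        have := h3.trans h4
        gcongr
      calc _ ≤ smoothH ν H Hf * (3 * bigNx f x R * t₀ ^ 2) := by gcongr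
        _ = _ := by rw [hA]; ring)
  have h1 := hz (p + t₀ • v)
  rw [bregman, add_sub_cancel_left, map_smul, smul_eq_mul] at hB
  have h2 := mul_le_mul_of_nonneg_left hv ht0.le
  have h3 : ε ^ 2 / (6 * A) = t₀ * ε - 3 * A * t₀ ^ 2 / 2 := by
    rw [ht₀]
    field_simp
    norm_num
  rw [h3]
  linarith

end Model

/-! ### Logarithms and the final count -/

/-- Either $r^T\le2$, the source of the 1 in the maximum, or $r^T\le2(r^T-1)\le2K$. -/
theorem natCast_mul_logb_le {r K : ℝ} {T : ℕ} (hr : 1 ≤ r) (hK : r ^ (T + 1) - 1 ≤ K) :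
    T * Real.logb 2 r ≤ max 1 (Real.logb 2 (2 * K)) := by
  rw [← Real.logb_pow]
  by_cases h : r ^ T ≤ 2
  · refine le_max_of_le_left ?_
    have := Real.logb_le_logb_of_le one_lt_two (by positivity) h
    rwa [Real.logb_self_eq_one one_lt_two] at this
  · refine le_max_of_le_right (Real.logb_le_logb_of_le one_lt_two (by positivity) ?_)
    have : r ^ T ≤ r ^ (T + 1) := pow_le_pow_right₀ hr T.le_succ
    linarith

theorem four_le_bigMH {ν H Hf : ℝ} (hν0 : 0 ≤ ν) (hHf : 0 < Hf) (hH : 6 / (3 + ν) * Hf < H)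
    (L₀ : ℝ) : 4 ≤ bigMH ν H Hf L₀ :=
  le_trans (by linarith [one_le_smoothH hν0 hHf hH]) (le_max_right _ _)

/-- The iteration bound in terms of the functional gap is dominated by the stated constant. -/
theorem logb_ratio_le_constC {f : E → ℝ} {x : E} {ν H Hf L₀ R ε β G : ℝ} (hν0 : 0 ≤ ν)
    (hHf : 0 < Hf) (hH : 6 / (3 + ν) * Hf < H) (hR : 1 ≤ R) (hε0 : 0 < ε) (hε1 : ε < 1)
    (hβ0 : 0 < β) (hβ : β ≤ bigNx f x R ^ 2 / 6)
    (hG : ε ^ 2 / (6 * (smoothH ν H Hf * bigNx f x R)) ≤ G) :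
    Real.logb 2 (2 * (muH ν H Hf * β / G)) ≤
      constC f x ν H Hf L₀ R + (3 + ν) * Real.logb 2 ε⁻¹ := by
  have hL := one_le_smoothH hν0 hHf hH
  have hM := four_le_bigMH hν0 hHf hH L₀
  have hLM : 4 * smoothH ν H Hf ≤ bigMH ν H Hf L₀ := le_max_right _ _
  have hμ := muH_pos hν0 hHf hH
  have hN : 0 < bigNx f x R := by
    rw [bigNx]
    positivity
  rw [constC]
  set μ := muH ν H Hf
  set L := smoothH ν H Hf
  set M := bigMH ν H Hf L₀
  set N := bigNx f x R
  have hL0 : 0 < L := by linarith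
  have hM0 : 0 < M := by linarith
  have hG0 : 0 < G := lt_of_lt_of_le (by positivity) hG
  have h2pos : 0 < (2 : ℝ) ^ (-(1 + ν)) := by positivity
  have hMp : 0 < M ^ (2 + ν) := by positivity
  rw [← Real.logb_rpow_eq_mul_logb_of_pos (inv_pos.2 hε0),
    ← Real.logb_mul (by positivity) (by positivity)]
  refine Real.logb_le_logb_of_le one_lt_two (by positivity) ?_
  -- The argument yields order $\epsilon^{-2}$; the exponent $3+\nu$, the power of $M$ and the
  -- factor $2^{1+\nu}$ are slack.
  have h1 : 2 * (μ * β / G) ≤ 2 * μ * L * N ^ 3 * ε⁻¹ ^ 2 := by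
    have e : μ * β / G ≤ μ * (N ^ 2 / 6) / (ε ^ 2 / (6 * (L * N))) := by gcongr
    refine (mul_le_mul_of_nonneg_left e zero_le_two).trans_eq ?_
    field_simp
  have h2 : ε⁻¹ ^ 2 ≤ ε⁻¹ ^ (3 + ν) := by
    rw [← Real.rpow_two]
    exact Real.rpow_le_rpow_of_exponent_le ((one_le_inv₀ hε0).2 hε1.le) (by linarith)
  have h3 : M ≤ M ^ (2 + ν) := by
    conv_lhs => rw [← Real.rpow_one M]
    exact Real.rpow_le_rpow_of_exponent_le (by linarith) (by linarith)
  have h4 : (2 : ℝ) ^ (-(1 + ν)) ≤ 1 :=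
    Real.rpow_le_one_of_one_le_of_nonpos one_le_two (by linarith)
  have h5 : 2 * μ * L * N ^ 3 ≤ 4 * (3 + ν) * M ^ (2 + ν) * N ^ 3 * μ := by
    have : 2 * L ≤ 4 * (3 + ν) * M ^ (2 + ν) := by nlinarith
    have h6 := mul_le_mul_of_nonneg_right this (by positivity : 0 ≤ N ^ 3 * μ)
    linarith
  have h6 : 4 * (3 + ν) * M ^ (2 + ν) * N ^ 3 * μ ≤
      4 * (3 + ν) * M ^ (2 + ν) * N ^ 3 * μ / (2 : ℝ) ^ (-(1 + ν)) :=
    le_div_self (by positivity) h2pos h4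
  exact h1.trans (mul_le_mul (h5.trans h6) h2 (by positivity) (by positivity))

end BregmanTensor

open BregmanTensor in
theorem mainTheorem2
    {E : Type*} [NormedAddCommGroup E] [InnerProductSpace ℝ E] [FiniteDimensional ℝ E]
    (f : E → ℝ) (ν Hf : ℝ) (hν0 : 0 ≤ ν) (hν1 : ν ≤ 1)
    (hf_conv : ConvexOn ℝ Set.univ f)
    (hf_diff : BregmanTensor.TimesDifferentiable 3 f)
    (hHf : 0 < Hf) (hf_holder : BregmanTensor.HolderDeriv 3 ν Hf f)
    (xstar x₀ x : E) (R₀ : ℝ)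
    (hmin : ∀ z : E, f xstar ≤ f z)
    (hx : f x ≤ f x₀)
    (hR : ∀ y : E, f y ≤ f x₀ → ‖y - xstar‖ ≤ R₀) (hR1 : 1 ≤ R₀)
    (H L₀ : ℝ) (hH : 6 / (3 + ν) * Hf < H) (hL₀ : 0 < L₀)
    (y : ℕ → E)
    (hy : BregmanTensor.GeneratedByBregmanMethod
      (BregmanTensor.tensorModel f x 3 H ν) (BregmanTensor.scaling f x ν) x L₀ y)
    (ε : ℝ) (hε0 : 0 < ε) (hε1 : ε < 1) (T : ℕ)
    (hT : ε < ‖fderiv ℝ (BregmanTensor.tensorModel f x 3 H ν) (y (T + 1))‖) :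
    ((T : ℝ) ≤
      (Real.logb 2 (BregmanTensor.bigMH ν H Hf L₀ /
        (BregmanTensor.bigMH ν H Hf L₀ - BregmanTensor.muH ν H Hf)))⁻¹ *
      max 1 (BregmanTensor.constC f x ν H Hf L₀ R₀ + (3 + ν) * Real.logb 2 ε⁻¹)) ∧
    (ε ≤ 1 / 2 →
      (T : ℝ) ≤
        (Real.logb 2 (BregmanTensor.bigMH ν H Hf L₀ /
          (BregmanTensor.bigMH ν H Hf L₀ - BregmanTensor.muH ν H Hf)))⁻¹ *
        (max (BregmanTensor.constC f x ν H Hf L₀ R₀) 0 + (3 + ν)) * Real.logb 2 ε⁻¹) := by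
  have hμ := muH_pos hν0 hHf hH
  have hμ1 := muH_lt_one hν0 hHf hH
  have hM4 := four_le_bigMH hν0 hHf hH L₀
  have hR' : ∀ w, f w ≤ f x₀ → ‖w - x‖ ≤ 2 * R₀ := fun w hw => by
    have h1 := norm_sub_le_norm_sub_add_norm_sub w xstar x
    have h2 := hR w hw
    have h3 := hR x hx
    rw [norm_sub_rev] at h3
    linarith
  have hsub : ∀ w, tensorModel f x 3 H ν w ≤ tensorModel f x 3 H ν x → ‖w - x‖ ≤ 2 * R₀ :=
    fun w hw => hR' w (by
      have h1 := le_tensorModel hν0 hf_diff hHf hf_holder hH x w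
      rw [tensorModel_self hν0] at hw
      linarith)
  have hnonneg := bregman_scaling_nonneg hν0 hf_conv hf_diff hHf hf_holder x
  have hstep := hy.step (M := bigMH ν H Hf L₀) (differentiable_scaling hf_diff hν0 x) hL₀ hnonneg
    (muH_mul_bregman_le hν0 hf_conv hf_diff hHf hf_holder hH x)
    (bregman_le_smoothH_mul hν0 hf_conv hf_diff hHf hf_holder hH x)
    (le_max_left _ _) (le_max_right _ _)
  have hy0 : y 0 = x := by
    obtain ⟨_, _, _, h0, -⟩ := hy
    exact h0
  obtain ⟨z, hz⟩ := exists_tensorModel_minimizer hν0 hf_diff hHf hf_holder hH hx hR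
  have hyT : ‖y (T + 1) - x‖ ≤ 2 * R₀ := hsub _ (by
    have := GeneratedByBregmanMethod.antitone hnonneg hstep (Nat.zero_le (T + 1))
    simpa only [hy0] using this)
  have hgap := gap_ge_of_norm_fderiv_gt hν0 hν1 hf_conv hf_diff hHf hf_holder hH hR1 hε0 hε1
    hyT hz hT
  have hβ := bregman_scaling_le hν0 hν1 hf_conv hf_diff hHf hf_holder hR1 (hsub z (hz x))
  have hconv := GeneratedByBregmanMethod.gap_mul_le hμ (by linarith) hnonneg hstep hz (T + 1)
  rw [hy0] at hconv
  have hMμ : 0 < bigMH ν H Hf L₀ - muH ν H Hf := by linarith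
  have hr : 1 < bigMH ν H Hf L₀ / (bigMH ν H Hf L₀ - muH ν H Hf) := by
    rw [lt_div_iff₀ hMμ]
    linarith
  have hG0 : 0 < tensorModel f x 3 H ν (y (T + 1)) - tensorModel f x 3 H ν z := by
    refine lt_of_lt_of_le ?_ hgap
    have h1 := one_le_smoothH hν0 hHf hH
    have h2 : 0 < bigNx f x R₀ := by
      rw [bigNx]
      positivity
    positivity
  have hpow : 0 < (bigMH ν H Hf L₀ / (bigMH ν H Hf L₀ - muH ν H Hf)) ^ (T + 1) - 1 :=
    sub_pos.2 (one_lt_pow₀ hr T.succ_ne_zero)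
  -- Positivity, needed for the logarithm, follows from the positive gap through the convergence
  -- estimate.
  have hβ0 : 0 < bregman (scaling f x ν) x z :=
    pos_of_mul_pos_right (lt_of_lt_of_le (mul_pos hG0 hpow) hconv) hμ.le
  have hlog := natCast_mul_logb_le hr.le ((le_div_iff₀' hG0).2 hconv)
  have hC := logb_ratio_le_constC (L₀ := L₀) hν0 hHf hH hR1 hε0 hε1 hβ0 hβ hgap
  have hlogr := Real.logb_pos one_lt_two hr
  have hmain := hlog.trans (max_le_max_left 1 hC)
  have hT1 := (le_inv_mul_iff₀' hlogr).2 hmain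
  refine ⟨hT1, fun hε2 => hT1.trans ?_⟩
  rw [mul_assoc]
  refine mul_le_mul_of_nonneg_left ?_ (inv_nonneg.2 hlogr.le)
  -- For $\epsilon\le\frac12$ this factor absorbs both the 1 in the maximum and the constant
  -- $C_{x,H}$.
  have hℓ : 1 ≤ Real.logb 2 ε⁻¹ := by
    rw [Real.le_logb_iff_rpow_le one_lt_two (inv_pos.2 hε0), Real.rpow_one,
      le_inv_comm₀ two_pos hε0]
    linarith
  have h0 : 0 ≤ max (constC f x ν H Hf L₀ R₀) 0 := le_max_right _ _
  have h1 : constC f x ν H Hf L₀ R₀ ≤ max (constC f x ν H Hf L₀ R₀) 0 := le_max_left _ _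
  have h2 := le_mul_of_one_le_right h0 hℓ
  refine max_le ?_ ?_ <;> nlinarith
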